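/- A map $f:X\to Y$ between metric spaces is called bornologous if for every $\delta<\infty$ the number $\sup\{\mathrm{diam}\,f(A): A\subset X,\ \mathrm{diam}\,A\le\delta\}$ is finite. Metric spaces $X,Y$ are bijectively coarsely equivalent if there are bijective bornologous maps $f:X\to Y$, $g:Y\to X$ and a real constant $K$ such that $\mathrm{dist}(g(f(x)),x)\le K$ and $\mathrm{dist}(f(g(y)),y)\le K$ for all $x\in X$, $y\in Y$. We write $\mathrm{asdim}(X)\le n$ if for every real $D\ge 0$ there is a cover of $X$ by sets of uniformly bounded diameter which is the union of $n+1$ subfamilies $\mathcal U_0,\dots,\mathcal U_n$ such that $\mathrm{dist}(U,V)\ge D$ for any distinct $U,V\in\mathcal U_i$, $i\le n$; $\mathrm{asdim}(X)$ is the smallest $n$ with $\mathrm{asdim}(X)\le n$, and $\infty$ if no such $n$ exists. All groups are countable and are endowed with proper left-invariant metrics (proper means that all closed balls are compact). Let $\mathbb Z^\infty$ be the direct sum of countably infinitely many copies of $\mathbb Z$. Theorem. Let $G$ be a countable group, and let $G$ and $\mathbb Z^\infty$ be endowed with arbitrary proper left-invariant metrics. Then $G$ is bijectively coarsely equivalent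 to $\mathbb Z^\infty$ if and only if $G$ is bijectively coarsely equivalent to some countable abelian group endowed with a proper left-invariant metric and $\mathrm{asdim}(G)=\infty$. -/

import Mathlib

universe u v

/-- A map between metric spaces is bornologous if its continuity modulus
`sup {diam (f A) : diam A ≤ δ}` is finite for every `δ < ∞`; as the diameter is a supremum of
distances of pairs of points, this is a condition on pairs of points. -/
def Bornologous {X : Type u} {Y : Type v} [MetricSpace X] [MetricSpace Y] (f : X → Y) : Prop :=
  ∀ δ : ℝ, ∃ ε : ℝ, ∀ x x' : X, dist x x' ≤ δ → dist (f x) (f x') ≤ ε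

/-- Two metric spaces are bijectively coarsely equivalent if there are bijective bornologous maps
in both directions whose two composites are at finite distance from the identity maps. -/
def BijectivelyCoarselyEquivalent (X : Type u) (Y : Type v) [MetricSpace X] [MetricSpace Y] :
    Prop :=
  ∃ (f : X → Y) (g : Y → X) (K : ℝ),
    Function.Bijective f ∧ Function.Bijective g ∧ Bornologous f ∧ Bornologous g ∧
      (∀ x : X, dist (g (f x)) x ≤ K) ∧ (∀ y : Y, dist (f (g y)) y ≤ K)

/-- A family of subsets of a metric space is `D`-discrete if any two distinct members of it are at
distance at least `D` from each other. -/
def IsDiscreteFamily {X : Type u} [MetricSpace X] (D : ℝ) (𝒰 : Set (Set X)) : Prop :=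
  ∀ U ∈ 𝒰, ∀ V ∈ 𝒰, U ≠ V → ∀ u ∈ U, ∀ v ∈ V, D ≤ dist u v

/-- `asdim X ≤ n`: for every `D ≥ 0` there is a cover of `X` of finite mesh (the diameters of its
members have a common finite bound `M`) that is the union of `n + 1` subfamilies each of which is
`D`-discrete. -/
def AsdimLE (X : Type u) [MetricSpace X] (n : ℕ) : Prop :=
  ∀ D : ℝ, 0 ≤ D → ∃ 𝒰 : Fin (n + 1) → Set (Set X),
    (∀ x : X, ∃ i, ∃ U ∈ 𝒰 i, x ∈ U) ∧
    (∃ M : ℝ, ∀ i, ∀ U ∈ 𝒰 i, ∀ x ∈ U, ∀ y ∈ U, dist x y ≤ M) ∧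
    (∀ i, IsDiscreteFamily D (𝒰 i))

/-- The asymptotic dimension: the smallest `n` with `asdim X ≤ n`, and `∞` if there is none. -/
noncomputable def asdim (X : Type u) [MetricSpace X] : ℕ∞ :=
  ⨅ (n : ℕ) (_ : AsdimLE X n), (n : ℕ∞)

/-! A countable group with a proper invariant metric has finite balls, so in the abelian case a map
is bornologous as soon as finite sets of differences go to finite sets of differences; the choice of
metric is immaterial. As `asdim` is a coarse invariant, two facts remain.

First, `asdim (ℕ →₀ ℤ) = ⊤`, because `ℤ ^ (n + 1)` does not have `asdim ≤ n`
(`not_asdimLE_of_injective`). From `n + 1` discrete families one builds mod 2 functions `f i`, each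
constant near every member of the `i`-th family and equal to a half-space indicator far from a
hyperplane. The cup product of their coboundaries has total sum 1 over the simplices of Kuhn's
triangulation, so some simplex has every `f i` changing along its `i`-th edge
(`exists_kuhnVertex_ne`); its least corner is then uncovered.

Second, an abelian group `A` of infinite `asdim` is equivalent to `ℕ →₀ ℤ`. A finitely generated
subgroup with torsion quotient would force finite `asdim` (`exists_asdimLE_of_torsion_quotient`), so
modulo every finitely generated subgroup there is an element of infinite order. Hence `A` is the
union of a chain `H 0 = ⊥ ≤ H 1 ≤ ...` with `H (n + 1) / H n` isomorphic to `ℤ/m ⊕ ℤ`, `m = m n`.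
Division with remainder by `m` identifies `ℤ` with this quotient as a set, and these digits give the
bijection `mixedRadix`, with finite control of differences both ways. -/

/-- The coarse structure of a group: differences in a finite set go to differences in a
finite set. -/
def PreservesFiniteDiff {A : Type u} {B : Type v} [AddGroup A] [AddGroup B] (f : A → B) : Prop :=
  ∀ F : Set A, F.Finite → ∃ F' : Set B, F'.Finite ∧ ∀ x y, x - y ∈ F → f x - f y ∈ F'

/-! ### Coarse invariance of asymptotic dimension -/

section Coarse

variable {X : Type*} {Y : Type*} {Z : Type*} [MetricSpace X] [MetricSpace Y] [MetricSpace Z]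

theorem Bornologous.comp {g : Y → Z} {f : X → Y} (hg : Bornologous g) (hf : Bornologous f) :
    Bornologous (g ∘ f) := by
  intro δ
  obtain ⟨ε, hε⟩ := hf δ
  obtain ⟨η, hη⟩ := hg ε
  exact ⟨η, fun x x' h => hη _ _ (hε _ _ h)⟩

theorem bijectivelyCoarselyEquivalent_iff_exists_equiv :
    BijectivelyCoarselyEquivalent X Y ↔
      ∃ e : X ≃ Y, Bornologous e ∧ Bornologous e.symm := by
  constructor
  · rintro ⟨f, g, K, hf, -, bf, bg, hgf, -⟩
    refine ⟨Equiv.ofBijective f hf, bf, fun δ => ?_⟩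
    obtain ⟨ε, hε⟩ := bg δ
    refine ⟨K + ε + K, fun y y' h => ?_⟩
    obtain ⟨x, rfl⟩ := (Equiv.ofBijective f hf).surjective y
    obtain ⟨x', rfl⟩ := (Equiv.ofBijective f hf).surjective y'
    rw [Equiv.symm_apply_apply, Equiv.symm_apply_apply]
    have h1 := hε _ _ h
    have h2 := hgf x
    have h3 := hgf x'
    have h4 := dist_triangle4 x (g (f x)) (g (f x')) x'
    rw [dist_comm x (g (f x))] at h4
    simp only [Equiv.ofBijective_apply] at h1
    linarith
  · rintro ⟨e, he, he'⟩
    exact ⟨e, e.symm, 0, e.bijective, e.symm.bijective, he, he', by simp, by simp⟩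

theorem BijectivelyCoarselyEquivalent.symm (h : BijectivelyCoarselyEquivalent X Y) :
    BijectivelyCoarselyEquivalent Y X := by
  rw [bijectivelyCoarselyEquivalent_iff_exists_equiv] at *
  obtain ⟨e, h1, h2⟩ := h
  exact ⟨e.symm, h2, h1⟩

theorem BijectivelyCoarselyEquivalent.trans (h : BijectivelyCoarselyEquivalent X Y)
    (h' : BijectivelyCoarselyEquivalent Y Z) : BijectivelyCoarselyEquivalent X Z := by
  rw [bijectivelyCoarselyEquivalent_iff_exists_equiv] at *
  obtain ⟨e, h1, h2⟩ := h
  obtain ⟨e', h1', h2'⟩ := h'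
  exact ⟨e.trans e', h1'.comp h1, h2.comp h2'⟩

theorem AsdimLE.of_bijectivelyCoarselyEquivalent {n : ℕ} (hX : AsdimLE X n)
    (h : BijectivelyCoarselyEquivalent X Y) : AsdimLE Y n := by
  obtain ⟨e, he, he'⟩ := bijectivelyCoarselyEquivalent_iff_exists_equiv.1 h
  intro D _
  obtain ⟨E, hE⟩ := he' D
  -- The `+ 1` makes the separation exceed `E` strictly; the `max` covers a negative `E`.
  obtain ⟨𝒰, hcov, ⟨M, hM⟩, hdisc⟩ := hX (max 0 (E + 1)) (le_max_left _ _)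
  obtain ⟨M', hM'⟩ := he M
  refine ⟨fun i => (fun U => e '' U) '' 𝒰 i, ?_, ⟨M', ?_⟩, ?_⟩
  · intro y
    obtain ⟨i, U, hU, hy⟩ := hcov (e.symm y)
    exact ⟨i, e '' U, ⟨U, hU, rfl⟩, e.symm y, hy, e.apply_symm_apply y⟩
  · rintro i _ ⟨U, hU, rfl⟩ _ ⟨x, hx, rfl⟩ _ ⟨x', hx', rfl⟩
    exact hM' _ _ (hM i U hU x hx x' hx')
  · rintro i _ ⟨U, hU, rfl⟩ _ ⟨V, hV, rfl⟩ hne _ ⟨x, hx, rfl⟩ _ ⟨x', hx', rfl⟩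
    by_contra hlt
    have h1 := hE _ _ (not_le.1 hlt).le
    rw [e.symm_apply_apply, e.symm_apply_apply] at h1
    have h2 := hdisc i U hU V hV (fun h => hne (by rw [h])) x hx x' hx'
    have h3 := le_max_right (0 : ℝ) (E + 1)
    linarith

theorem asdim_eq_top_iff : asdim X = ⊤ ↔ ∀ n, ¬ AsdimLE X n := by
  simp [asdim, iInf_eq_top]

theorem asdim_eq_top_of_bijectivelyCoarselyEquivalent (hX : asdim X = ⊤)
    (h : BijectivelyCoarselyEquivalent X Y) : asdim Y = ⊤ := by
  rw [asdim_eq_top_iff] at *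
  exact fun n hn => hX n (hn.of_bijectivelyCoarselyEquivalent h.symm)

end Coarse

/-! ### Proper invariant metrics on countable abelian groups -/

section InvariantMetric

variable {A : Type u} [AddCommGroup A] [MetricSpace A] [IsIsometricVAdd A A]

theorem dist_eq_dist_sub_zero (x y : A) : dist x y = dist (x - y) 0 := by
  have h := dist_vadd y (x - y) 0
  simpa using h

/-- By Baire's theorem a countable complete space has an isolated point; translations make every
point isolated, and compact discrete sets are finite. -/
theorem finite_closedBall_of_countable [Countable A] [ProperSpace A] (x : A) (r : ℝ) :
    (Metric.closedBall x r).Finite := by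
  obtain ⟨a, ha⟩ : ∃ a : A, (interior ({a} : Set A)).Nonempty :=
    nonempty_interior_of_iUnion_of_closed (fun a : A => isClosed_singleton)
      (Set.iUnion_of_singleton A)
  have hopen : IsOpen ({a} : Set A) := by
    have h1 : interior ({a} : Set A) = {a} :=
      (Set.subset_singleton_iff_eq.1 interior_subset).resolve_left ha.ne_empty
    rw [← h1]
    exact isOpen_interior
  have hdisc : DiscreteTopology A := by
    refine discreteTopology_iff_isOpen_singleton.2 fun b => ?_
    obtain ⟨ε, hε, hball⟩ := Metric.isOpen_iff.1 hopen a rfl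
    refine Metric.isOpen_iff.2 fun c hc => ⟨ε, hε, fun y hy => ?_⟩
    rw [Set.mem_singleton_iff] at hc
    subst hc
    have h1 : y - c + a ∈ Metric.ball a ε := by
      rw [Metric.mem_ball, dist_eq_dist_sub_zero, add_sub_cancel_right, ← dist_eq_dist_sub_zero]
      exact hy
    have h2 : y - c + a = a := hball h1
    exact sub_eq_zero.1 (add_eq_right.1 h2)
  exact (isCompact_closedBall x r).finite_of_discrete

theorem bornologous_of_preservesFiniteDiff [Countable A] [ProperSpace A] {B : Type*}
    [AddCommGroup B] [MetricSpace B] [IsIsometricVAdd B B] {f : A → B}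
    (hf : PreservesFiniteDiff f) : Bornologous f := by
  intro δ
  obtain ⟨F, hF, hfF⟩ := hf _ (finite_closedBall_of_countable 0 δ)
  obtain ⟨ε, hε⟩ := (hF.image fun b => dist b 0).bddAbove
  refine ⟨ε, fun x y h => ?_⟩
  rw [dist_eq_dist_sub_zero] at h ⊢
  exact hε ⟨_, hfF x y h, rfl⟩

/-- Needed because the abelian group in the main theorem lives in an arbitrary universe. -/
theorem exists_uLift_invariantMetric [Countable A] [ProperSpace A] :
    ∃ (B : Type (max u v)) (_ : AddCommGroup B) (_ : Countable B)
      (_ : MetricSpace B) (_ : ProperSpace B) (_ : IsIsometricVAdd B B),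
      BijectivelyCoarselyEquivalent A B := by
  refine ⟨ULift.{v} A, inferInstance, inferInstance, inferInstance, ⟨fun x r => ?_⟩,
    ⟨fun c x y => ?_⟩, ?_⟩
  · refine Set.Finite.isCompact ?_
    exact (finite_closedBall_of_countable x.down r).preimage ULift.down_injective.injOn
  · rw [edist_dist, edist_dist]
    exact congrArg ENNReal.ofReal (dist_vadd c.down x.down y.down)
  · rw [bijectivelyCoarselyEquivalent_iff_exists_equiv]
    exact ⟨Equiv.ulift.symm, fun δ => ⟨δ, fun x y h => h⟩, fun δ => ⟨δ, fun x y h => h⟩⟩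

end InvariantMetric

/-! ### Lower bound: asymptotic dimension of lattices via mod 2 cup products -/

section Kuhn

variable {n : ℕ}

/-- The vertices of the simplices of Kuhn's subdivision of the unit cube with least corner `v`. -/
def kuhnVertex (v : Fin (n + 1) → ℤ) (π : Equiv.Perm (Fin (n + 1))) (i : ℕ) : Fin (n + 1) → ℤ :=
  fun l => v l + if (π.symm l : ℕ) < i then 1 else 0

theorem le_kuhnVertex (v : Fin (n + 1) → ℤ) (π : Equiv.Perm (Fin (n + 1))) (i : ℕ)
    (l : Fin (n + 1)) : v l ≤ kuhnVertex v π i l := by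
  unfold kuhnVertex
  split_ifs <;> omega

theorem kuhnVertex_le (v : Fin (n + 1) → ℤ) (π : Equiv.Perm (Fin (n + 1))) (i : ℕ)
    (l : Fin (n + 1)) : kuhnVertex v π i l ≤ v l + 1 := by
  unfold kuhnVertex
  split_ifs <;> omega

/-- Two simplices of the same cube that share the face opposite the inner vertex `b`. -/
theorem kuhnVertex_mul_swap (v : Fin (n + 1) → ℤ) (π : Equiv.Perm (Fin (n + 1)))
    {a b : Fin (n + 1)} (hab : (b : ℕ) = a + 1) {i : ℕ} (hi : i ≠ b) :
    kuhnVertex v (π * Equiv.swap a b) i = kuhnVertex v π i := by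
  funext l
  unfold kuhnVertex
  have h : (π * Equiv.swap a b).symm l = Equiv.swap a b (π.symm l) := rfl
  rw [h]
  rw [Equiv.swap_apply_def]
  split_ifs <;> simp_all <;> omega

/-- The face of a simplex opposite its vertex 0 is the face, opposite the last vertex, of a simplex
in an adjacent cube. -/
theorem kuhnVertex_succ (v : Fin (n + 1) → ℤ) (π : Equiv.Perm (Fin (n + 1))) {i : ℕ}
    (hi : i ≤ n) :
    kuhnVertex v π (i + 1)
      = kuhnVertex (v + Pi.single (π 0) 1) (π * finRotate (n + 1)) i := by
  funext l
  have h : (π * finRotate (n + 1)).symm l = (finRotate (n + 1)).symm (π.symm l) := rfl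
  unfold kuhnVertex
  rw [h]
  obtain ⟨x, rfl⟩ := π.surjective l
  obtain ⟨y, rfl⟩ := (finRotate (n + 1)).surjective x
  rw [Equiv.symm_apply_apply, Equiv.symm_apply_apply, Pi.add_apply]
  by_cases hy : y = Fin.last n
  · subst hy
    rw [finRotate_last, Pi.single_eq_same]
    simp
    omega
  · have h1 : finRotate (n + 1) y ≠ 0 := fun h0 => by
      have := coe_finRotate_of_ne_last hy
      rw [h0] at this
      simp at this
    rw [Pi.single_eq_of_ne (fun h0 => h1 (π.injective h0)), coe_finRotate_of_ne_last hy]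
    simp

/-- Simplices cancel in pairs mod 2: swapping positions `j - 1` and `j` is a fixed-point-free
involution that moves only the vertex `j`. -/
theorem sum_kuhnVertex_eq_zero (v : Fin (n + 1) → ℤ) {F : (ℕ → Fin (n + 1) → ℤ) → ZMod 2} {j : ℕ}
    (hj0 : 0 < j) (hjn : j ≤ n)
    (hF : ∀ s s' : ℕ → Fin (n + 1) → ℤ, (∀ i, i ≠ j → s i = s' i) → F s = F s') :
    ∑ π : Equiv.Perm (Fin (n + 1)), F (kuhnVertex v π) = 0 := by
  have hne : (⟨j - 1, by omega⟩ : Fin (n + 1)) ≠ ⟨j, by omega⟩ := by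
    intro h
    have := Fin.val_eq_of_eq h
    simp only at this
    omega
  refine Finset.sum_involution
    (fun π _ => π * Equiv.swap (⟨j - 1, by omega⟩ : Fin (n + 1)) ⟨j, by omega⟩) ?_ ?_ ?_ ?_
  · intro π _
    rw [hF _ (kuhnVertex v π) fun i hi =>
      kuhnVertex_mul_swap v π (by simp only; omega) (by simpa using hi)]
    exact CharTwo.add_self_eq_zero _
  · intro π _ _ h
    exact hne (Equiv.swap_eq_one_iff.1 (mul_eq_left.1 h))
  · simp
  · intro π _
    rw [mul_assoc, Equiv.swap_mul_self, mul_one]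

theorem prod_eq_prod_add_prod {ι R : Type*} [Fintype ι] [DecidableEq ι] [CommRing R] (j : ι)
    {p q r : ι → R} (hp : ∀ i, i ≠ j → p i = r i) (hq : ∀ i, i ≠ j → q i = r i)
    (hj : r j = p j + q j) : ∏ i, r i = ∏ i, p i + ∏ i, q i := by
  rw [← Finset.mul_prod_erase _ p (Finset.mem_univ j),
    ← Finset.mul_prod_erase _ q (Finset.mem_univ j),
    ← Finset.mul_prod_erase _ r (Finset.mem_univ j),
    Finset.prod_congr rfl fun i hi => hp i (Finset.ne_of_mem_erase hi),
    Finset.prod_congr rfl fun i hi => hq i (Finset.ne_of_mem_erase hi), hj, add_mul]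

/-- The value on the simplex with vertices `s` of the cup product of the coboundaries of the
functions `f i`. -/
def cupCoboundary (f : Fin (n + 1) → (Fin (n + 1) → ℤ) → ZMod 2) (s : ℕ → Fin (n + 1) → ℤ) :
    ZMod 2 :=
  ∏ i : Fin (n + 1), (f i (s i) + f i (s (i + 1)))

/-- The factors of the cup product in which the `k`-th factor is the function `f k` itself. -/
def primitiveFactor (f : Fin (n + 1) → (Fin (n + 1) → ℤ) → ZMod 2) (k : Fin (n + 1))
    (s : ℕ → Fin (n + 1) → ℤ) (i : Fin (n + 1)) : ZMod 2 :=
  if (i : ℕ) < k then f i (s i) + f i (s (i + 1))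
  else if (i : ℕ) = k then f i (s i) else f i (s (i - 1)) + f i (s i)

/-- The products interpolating between the first and the last face of a simplex. -/
def primitiveProduct (f : Fin (n + 1) → (Fin (n + 1) → ℤ) → ZMod 2) (k : Fin (n + 1))
    (s : ℕ → Fin (n + 1) → ℤ) (j : ℕ) : ZMod 2 :=
  ∏ i : Fin (n + 1), if (i : ℕ) < j then primitiveFactor f k s i
    else primitiveFactor f k (fun l => s (l + 1)) i

/-- The consecutive sums of the interpolating products. -/
def primitiveStep (f : Fin (n + 1) → (Fin (n + 1) → ℤ) → ZMod 2) (k : Fin (n + 1))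
    (s : ℕ → Fin (n + 1) → ℤ) (j : ℕ) : ZMod 2 :=
  ∏ i : Fin (n + 1), if (i : ℕ) < j then primitiveFactor f k s i
    else if (i : ℕ) = j then
      primitiveFactor f k s i + primitiveFactor f k (fun l => s (l + 1)) i
    else primitiveFactor f k (fun l => s (l + 1)) i

variable (f : Fin (n + 1) → (Fin (n + 1) → ℤ) → ZMod 2) (k : Fin (n + 1))

theorem primitiveStep_eq (s : ℕ → Fin (n + 1) → ℤ) {j : ℕ} (hj : j < n + 1) :
    primitiveStep f k s j = primitiveProduct f k s (j + 1) - primitiveProduct f k s j := by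
  rw [CharTwo.sub_eq_add]
  refine prod_eq_prod_add_prod ⟨j, hj⟩ (fun i hi => ?_) (fun i hi => ?_) ?_
  · have h : (i : ℕ) ≠ j := fun h => hi (Fin.ext h)
    rw [if_neg h]
    split_ifs <;> first | rfl | omega
  · have h : (i : ℕ) ≠ j := fun h => hi (Fin.ext h)
    rw [if_neg h]
  · simp

theorem primitiveStep_self (s : ℕ → Fin (n + 1) → ℤ) :
    primitiveStep f k s k = cupCoboundary f s := by
  refine Finset.prod_congr rfl fun i _ => ?_
  unfold primitiveFactor
  rcases lt_trichotomy (i : ℕ) k with h | h | h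
  · rw [if_pos h, if_pos h]
  · simp [h]
  · have h4 : (i : ℕ) - 1 + 1 = i := by omega
    simp [h.ne', h.not_gt, h4]

/-- In the `j`-th factor the two copies of a middle value cancel, so the product ignores one inner
vertex: `j + 1` if `j < k`, and `j` if `j > k`. -/
theorem sum_primitiveStep_eq_zero (v : Fin (n + 1) → ℤ) {j : ℕ} (hj : j < n + 1)
    (hjk : j ≠ k) :
    ∑ π : Equiv.Perm (Fin (n + 1)), primitiveStep f k (kuhnVertex v π) j = 0 := by
  have hk := k.isLt
  rcases lt_or_gt_of_ne hjk with h | h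
  · refine sum_kuhnVertex_eq_zero v (F := fun s => primitiveStep f k s j) (j := j + 1) (by omega) (by omega) fun s s' hs => ?_
    simp only [primitiveStep, primitiveFactor]
    refine Finset.prod_congr rfl fun i _ => ?_
    by_cases hij : (i : ℕ) < j
    · rw [if_pos hij, if_pos hij, if_pos (by omega), if_pos (by omega), hs _ (by omega),
        hs _ (by omega)]
    rw [if_neg hij, if_neg hij]
    by_cases hij' : (i : ℕ) = j
    · rw [if_pos hij', if_pos hij', if_pos (by omega), if_pos (by omega), if_pos (by omega),
        if_pos (by omega), hs i (by omega), hs (i + 1 + 1) (by omega)]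
      linear_combination (CharTwo.add_self_eq_zero (f i (s (i + 1))))
        - (CharTwo.add_self_eq_zero (f i (s' (i + 1))))
    · rw [if_neg hij', if_neg hij']
      split_ifs
      · rw [hs _ (by omega), hs _ (by omega)]
      · rw [hs _ (by omega)]
      · rw [hs _ (by omega), hs _ (by omega)]
  · refine sum_kuhnVertex_eq_zero v (F := fun s => primitiveStep f k s j) (j := j) (by omega) (by omega) fun s s' hs => ?_
    simp only [primitiveStep, primitiveFactor]
    refine Finset.prod_congr rfl fun i _ => ?_
    by_cases hij : (i : ℕ) < j
    · rw [if_pos hij, if_pos hij]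
      split_ifs
      · rw [hs _ (by omega), hs _ (by omega)]
      · rw [hs _ (by omega)]
      · rw [hs _ (by omega), hs _ (by omega)]
    have h1 : ¬ (i : ℕ) < k := by omega
    have h2 : ¬ (i : ℕ) = k := by omega
    have h3 : (i : ℕ) - 1 + 1 = i := by omega
    simp only [if_neg hij, if_neg h1, if_neg h2, h3]
    rw [hs (i + 1) (by omega)]
    by_cases hij' : (i : ℕ) = j
    · rw [if_pos hij', if_pos hij', hs (i - 1) (by omega)]
      linear_combination (CharTwo.add_self_eq_zero (f i (s i)))
        - (CharTwo.add_self_eq_zero (f i (s' i)))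
    · rw [if_neg hij', if_neg hij', hs i hij']

/-- Leibniz rule summed over a cube: the cup product is the coboundary of the product with `f k`
left undifferentiated. Only the first and last faces survive, by telescoping. -/
theorem sum_cupCoboundary (v : Fin (n + 1) → ℤ) :
    ∑ π : Equiv.Perm (Fin (n + 1)), cupCoboundary f (kuhnVertex v π)
      = ∑ π : Equiv.Perm (Fin (n + 1)), primitiveProduct f k (kuhnVertex v π) (n + 1)
        - ∑ π : Equiv.Perm (Fin (n + 1)), primitiveProduct f k (kuhnVertex v π) 0 := by
  have h : ∀ π : Equiv.Perm (Fin (n + 1)),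
      primitiveProduct f k (kuhnVertex v π) (n + 1) - primitiveProduct f k (kuhnVertex v π) 0
        = ∑ j ∈ Finset.range (n + 1), primitiveStep f k (kuhnVertex v π) j := by
    intro π
    rw [← Finset.sum_range_sub]
    exact Finset.sum_congr rfl fun j hj => (primitiveStep_eq f k _ (Finset.mem_range.1 hj)).symm
  rw [← Finset.sum_sub_distrib, Finset.sum_congr rfl fun π _ => h π, Finset.sum_comm,
    Finset.sum_eq_single (k : ℕ)]
  · exact Finset.sum_congr rfl fun π _ => (primitiveStep_self f k _).symm
  · exact fun j hj hjk => sum_primitiveStep_eq_zero f k v (Finset.mem_range.1 hj) hjk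
  · exact fun h => absurd (Finset.mem_range.2 k.isLt) h

theorem primitiveProduct_zero_kuhnVertex (v : Fin (n + 1) → ℤ) (π : Equiv.Perm (Fin (n + 1))) :
    primitiveProduct f k (kuhnVertex v π) 0
      = primitiveProduct f k
        (kuhnVertex (v + Pi.single (π 0) 1) (π * finRotate (n + 1))) (n + 1) := by
  refine Finset.prod_congr rfl fun i _ => ?_
  have hi := i.isLt
  have hk := k.isLt
  rw [if_neg (by omega), if_pos hi]
  unfold primitiveFactor
  split_ifs
  · rw [← kuhnVertex_succ v π (by omega : (i : ℕ) ≤ n),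
      ← kuhnVertex_succ v π (by omega : (i : ℕ) + 1 ≤ n)]
  · rw [← kuhnVertex_succ v π (by omega : (i : ℕ) ≤ n)]
  · rw [← kuhnVertex_succ v π (by omega : (i : ℕ) ≤ n),
      ← kuhnVertex_succ v π (by omega : (i : ℕ) - 1 ≤ n)]

/-- The lattice points of a cube centred at the origin. -/
noncomputable def latticeCube (n : ℕ) (L : ℤ) : Finset (Fin (n + 1) → ℤ) :=
  Fintype.piFinset fun _ => Finset.Icc (-L) L

theorem mem_latticeCube {L : ℤ} {v : Fin (n + 1) → ℤ} :
    v ∈ latticeCube n L ↔ ∀ i, -L ≤ v i ∧ v i ≤ L := by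
  simp [latticeCube]

theorem sum_latticeCube_add {L : ℤ} {R : Type*} [AddCommMonoid R] (F : (Fin (n + 1) → ℤ) → R)
    (e : Fin (n + 1) → ℤ) (hF : ∀ v, F v ≠ 0 → v ∈ latticeCube n L ∧ v - e ∈ latticeCube n L) :
    ∑ v ∈ latticeCube n L, F (v + e) = ∑ v ∈ latticeCube n L, F v := by
  rw [← finsum_eq_sum_of_support_subset F fun v hv => (hF v hv).1,
    ← finsum_eq_sum_of_support_subset (fun v => F (v + e)) fun v hv => by
      simpa using (hF _ hv).2]
  exact finsum_comp_equiv (Equiv.addRight e)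

/-- Outside a slab, `f` is the indicator function of the half-space `0 ≤ x i`. -/
def IsHalfSpaceOutside (M : ℤ) (i : Fin (n + 1)) (f : (Fin (n + 1) → ℤ) → ZMod 2) : Prop :=
  ∀ x, M ≤ |x i| → f x = if 0 ≤ x i then 1 else 0

variable {f k}

theorem IsHalfSpaceOutside.eq_of_notMem {M : ℤ} (hM : 0 < M) {i : Fin (n + 1)}
    {g : (Fin (n + 1) → ℤ) → ZMod 2} (hg : IsHalfSpaceOutside M i g) {v : ℤ}
    (hv : v < -(M + 1) ∨ M + 1 < v) {x y : Fin (n + 1) → ℤ} (hx : v ≤ x i) (hx' : x i ≤ v + 1)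
    (hy : v ≤ y i) (hy' : y i ≤ v + 1) : g x + g y = 0 := by
  rw [hg x (le_abs.2 (by omega)), hg y (le_abs.2 (by omega))]
  split_ifs <;> first | omega | rfl

/-- If the coordinate `v i` is too large, the `i`-th factor vanishes: it is the coboundary of a
half-space away from its boundary, or `f k` outside its slab. -/
theorem mem_of_primitiveProduct_ne_zero {M : ℤ} (hM : 0 < M)
    (hf : ∀ i, i ≠ k → IsHalfSpaceOutside M i (f i)) (hk : ∀ x, M ≤ |x k| → f k x = 0)
    {v : Fin (n + 1) → ℤ} {π : Equiv.Perm (Fin (n + 1))}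
    (hne : primitiveProduct f k (kuhnVertex v π) (n + 1) ≠ 0) : v ∈ latticeCube n (M + 1) := by
  rw [mem_latticeCube]
  by_contra! hcon
  obtain ⟨i, hi⟩ := hcon
  have hi' : v i < -(M + 1) ∨ M + 1 < v i := by
    by_contra hc
    have := hi (by omega)
    omega
  refine hne (Finset.prod_eq_zero (Finset.mem_univ i) ?_)
  rw [if_pos i.isLt]
  have h1 := fun l => le_kuhnVertex v π l i
  have h2 := fun l => kuhnVertex_le v π l i
  unfold primitiveFactor
  split_ifs with hlt heq
  · exact (hf i fun h => hlt.ne (congrArg _ h)).eq_of_notMem hM hi' (h1 _) (h2 _) (h1 _) (h2 _)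
  · have hik : i = k := Fin.ext heq
    subst hik
    have h3 := h1 i
    have h4 := h2 i
    exact hk _ (le_abs.2 (by omega))
  · exact (hf i fun h => heq (congrArg _ h)).eq_of_notMem hM hi' (h1 _) (h2 _) (h1 _) (h2 _)

/-- A boundedly supported primitive makes the total sum vanish: the first-face terms are unit
translates of the last-face terms. The radius `M + 2` leaves room for the translation of a support
of radius `M + 1`. -/
theorem sum_sum_cupCoboundary_eq_zero {M : ℤ} (hM : 0 < M)
    (hf : ∀ i, i ≠ k → IsHalfSpaceOutside M i (f i)) (hk : ∀ x, M ≤ |x k| → f k x = 0) :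
    ∑ v ∈ latticeCube n (M + 2), ∑ π : Equiv.Perm (Fin (n + 1)),
      cupCoboundary f (kuhnVertex v π) = 0 := by
  rw [Finset.sum_congr rfl fun v _ => sum_cupCoboundary f k v, Finset.sum_sub_distrib,
    sub_eq_zero, Finset.sum_comm, Finset.sum_comm (s := latticeCube n (M + 2))]
  rw [← Equiv.sum_comp (Equiv.mulRight (finRotate (n + 1)))]
  refine Finset.sum_congr rfl fun π _ => ?_
  simp only [primitiveProduct_zero_kuhnVertex, Equiv.coe_mulRight]
  refine (sum_latticeCube_add (fun v => primitiveProduct f k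
    (kuhnVertex v (π * finRotate (n + 1))) (n + 1)) _ fun v hv => ?_).symm
  have h := mem_latticeCube.1 (mem_of_primitiveProduct_ne_zero hM hf hk hv)
  refine ⟨mem_latticeCube.2 fun i => ?_, mem_latticeCube.2 fun i => ?_⟩
  · have := h i
    omega
  · have := h i
    rw [Pi.sub_apply, Pi.single_apply]
    split_ifs <;> omega

/-- The cup product is additive in the `k`-th function, and `f k + g k` vanishes outside the slab.
-/
theorem sum_sum_cupCoboundary_congr {M : ℤ} (hM : 0 < M)
    {f g : Fin (n + 1) → (Fin (n + 1) → ℤ) → ZMod 2} (hf : ∀ i, IsHalfSpaceOutside M i (f i))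
    (hg : ∀ i, IsHalfSpaceOutside M i (g i)) (hfg : ∀ i, i ≠ k → f i = g i) :
    ∑ v ∈ latticeCube n (M + 2), ∑ π : Equiv.Perm (Fin (n + 1)),
        cupCoboundary f (kuhnVertex v π)
      = ∑ v ∈ latticeCube n (M + 2), ∑ π : Equiv.Perm (Fin (n + 1)),
        cupCoboundary g (kuhnVertex v π) := by
  have h0 := sum_sum_cupCoboundary_eq_zero (f := Function.update f k (f k + g k)) (k := k) hM
    (fun i hi => by rw [Function.update_of_ne hi]; exact hf i)
    (fun x hx => by
      rw [Function.update_self, Pi.add_apply, hf k x hx, hg k x hx]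
      exact CharTwo.add_self_eq_zero _)
  rw [← sub_eq_zero, ← h0, ← Finset.sum_sub_distrib]
  refine Finset.sum_congr rfl fun v _ => ?_
  rw [← Finset.sum_sub_distrib]
  refine Finset.sum_congr rfl fun π _ => ?_
  rw [CharTwo.sub_eq_add]
  refine (prod_eq_prod_add_prod k (fun i hi => ?_) (fun i hi => ?_) ?_).symm
  · rw [Function.update_of_ne hi]
  · rw [Function.update_of_ne hi, hfg i hi]
  · rw [Function.update_self, Pi.add_apply, Pi.add_apply]
    ring

/-- The indicator functions of the half-spaces. -/
def halfSpace (i : Fin (n + 1)) (x : Fin (n + 1) → ℤ) : ZMod 2 := if 0 ≤ x i then 1 else 0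

theorem cupCoboundary_halfSpace (v : Fin (n + 1) → ℤ) (π : Equiv.Perm (Fin (n + 1)))
    (h : cupCoboundary halfSpace (kuhnVertex v π) ≠ 0) : v = (fun _ => -1) ∧ π = 1 := by
  have key : ∀ i, v i = -1 ∧ π.symm i = i := by
    intro i
    have h1 := Finset.prod_ne_zero_iff.1 h i (Finset.mem_univ i)
    unfold halfSpace kuhnVertex at h1
    by_contra hcon
    refine h1 ?_
    rw [Fin.ext_iff] at hcon
    split_ifs <;> first | omega | rfl
  refine ⟨funext fun i => (key i).1, Equiv.ext fun i => ?_⟩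
  exact (Equiv.symm_apply_eq π).1 (key i).2 |>.symm

theorem sum_sum_cupCoboundary_halfSpace {M : ℤ} (hM : 0 < M) :
    ∑ v ∈ latticeCube n (M + 2), ∑ π : Equiv.Perm (Fin (n + 1)),
      cupCoboundary halfSpace (kuhnVertex v π) = 1 := by
  rw [Finset.sum_eq_single (fun _ => -1), Finset.sum_eq_single 1]
  · refine Finset.prod_eq_one fun i _ => ?_
    have h : (1 : Equiv.Perm (Fin (n + 1))).symm i = i := rfl
    simp [halfSpace, kuhnVertex, h]
  · intro π _ hπ
    by_contra h
    exact hπ (cupCoboundary_halfSpace _ _ h).2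
  · simp
  · intro v _ hv
    refine Finset.sum_eq_zero fun π _ => ?_
    by_contra h
    exact hv (cupCoboundary_halfSpace _ _ h).1
  · intro h
    refine absurd (mem_latticeCube.2 fun i => ?_) h
    omega

theorem exists_kuhnVertex_ne {M : ℤ} (hM : 0 < M)
    {f : Fin (n + 1) → (Fin (n + 1) → ℤ) → ZMod 2} (hf : ∀ i, IsHalfSpaceOutside M i (f i)) :
    ∃ v π, ∀ i : Fin (n + 1), f i (kuhnVertex v π i) ≠ f i (kuhnVertex v π (i + 1)) := by
  -- Replace the half-spaces by the `f i` one at a time.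
  have key : ∀ j : ℕ, ∑ v ∈ latticeCube n (M + 2), ∑ π : Equiv.Perm (Fin (n + 1)),
      cupCoboundary (fun i => if (i : ℕ) < j then f i else halfSpace i) (kuhnVertex v π)
        = 1 := by
    have hmix : ∀ j : ℕ, ∀ i : Fin (n + 1),
        IsHalfSpaceOutside M i (if (i : ℕ) < j then f i else halfSpace i) := by
      intro j i
      split_ifs
      · exact hf i
      · exact fun x _ => rfl
    intro j
    induction j with
    | zero => simpa using sum_sum_cupCoboundary_halfSpace hM
    | succ j ih =>
      rw [← ih]
      by_cases hj : j < n + 1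
      · refine sum_sum_cupCoboundary_congr (k := ⟨j, hj⟩) hM (hmix _) (hmix _) fun i hi => ?_
        have h : (i : ℕ) ≠ j := fun h => hi (Fin.ext h)
        have h1 : (i : ℕ) < j + 1 ↔ (i : ℕ) < j := by omega
        simp only [h1]
      · refine Finset.sum_congr rfl fun v _ => Finset.sum_congr rfl fun π _ => ?_
        congr 1
        funext i
        rw [if_pos (by omega), if_pos (by omega)]
  have h1 := key (n + 1)
  simp only [Fin.is_lt, if_true] at h1
  obtain ⟨v, -, hv⟩ := Finset.exists_ne_zero_of_sum_ne_zero (h1 ▸ one_ne_zero)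
  obtain ⟨π, -, hπ⟩ := Finset.exists_ne_zero_of_sum_ne_zero hv
  refine ⟨v, π, fun i hi => Finset.prod_ne_zero_iff.1 hπ i (Finset.mem_univ i) ?_⟩
  simp only [hi]
  exact CharTwo.add_self_eq_zero _

/-- Lebesgue's covering theorem for a lattice: a group containing `ℤ ^ (n + 1)` has asymptotic
dimension greater than `n`. -/
theorem not_asdimLE_of_injective {A : Type*} [AddCommGroup A] [Countable A] [MetricSpace A]
    [ProperSpace A] [IsIsometricVAdd A A] (φ : (Fin (n + 1) → ℤ) →+ A)
    (hφ : Function.Injective φ) : ¬ AsdimLE A n := by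
  classical
  intro h
  obtain ⟨D, hD⟩ := ((latticeCube n 1).finite_toSet.image fun u => dist (φ u) 0).bddAbove
  obtain ⟨𝒰, hcov, ⟨m, hm⟩, hdisc⟩ := h (max 0 (D + 1)) (le_max_left _ _)
  obtain ⟨B, hB0, hB⟩ : ∃ B : ℤ, 0 ≤ B ∧ ∀ u, dist (φ u) 0 ≤ m → ∀ i, |u i| ≤ B := by
    have hfin : {u | dist (φ u) 0 ≤ m}.Finite :=
      (finite_closedBall_of_countable (0 : A) m).preimage hφ.injOn
    obtain ⟨B, hB⟩ := (hfin.image fun u => ∑ i, |u i|).bddAbove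
    refine ⟨max B 0, le_max_right _ _, fun u hu i => le_trans ?_ (le_max_left _ _)⟩
    exact le_trans (Finset.single_le_sum (f := fun i => |u i|) (fun _ _ => abs_nonneg _)
      (Finset.mem_univ i)) (hB ⟨u, hu, rfl⟩)
  let near : (Fin (n + 1) → ℤ) → (Fin (n + 1) → ℤ) → Prop :=
    fun u x => ∀ l, u l ≤ x l ∧ x l ≤ u l + 1
  -- The half-space indicator, modified to be constant near each member `U` of the `i`-th family:
  -- there the value is 1 exactly when `U` meets the half-space.
  let f : Fin (n + 1) → (Fin (n + 1) → ℤ) → ZMod 2 := fun i x =>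
    if (∃ U ∈ 𝒰 i, (∃ u, φ u ∈ U ∧ near u x) ∧ ∃ w, φ w ∈ U ∧ 0 ≤ w i) ∨
      (0 ≤ x i ∧ ¬ ∃ U ∈ 𝒰 i, ∃ u, φ u ∈ U ∧ near u x) then 1 else 0
  -- Two corners of unit cubes containing `x` differ by a vector in `latticeCube n 1`, whose image
  -- has norm at most `D`.
  have huniq : ∀ i, ∀ U ∈ 𝒰 i, ∀ V ∈ 𝒰 i, ∀ x, (∃ u, φ u ∈ U ∧ near u x) →
      (∃ u, φ u ∈ V ∧ near u x) → U = V := by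
    rintro i U hU V hV x ⟨u, hu, hux⟩ ⟨u', hu', hux'⟩
    by_contra hne
    have h1 := hdisc i U hU V hV hne _ hu _ hu'
    have h2 : dist (φ (u - u')) 0 ≤ D := hD ⟨u - u', by
      rw [Finset.mem_coe, mem_latticeCube]
      intro l
      have := hux l
      have := hux' l
      rw [Pi.sub_apply]
      omega, rfl⟩
    rw [map_sub, ← dist_eq_dist_sub_zero] at h2
    have h3 := le_max_right (0 : ℝ) (D + 1)
    linarith
  have hconst : ∀ i, ∀ U ∈ 𝒰 i, ∀ x, (∃ u, φ u ∈ U ∧ near u x) →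
      f i x = if ∃ w, φ w ∈ U ∧ 0 ≤ w i then 1 else 0 := by
    intro i U hU x hx
    refine if_congr ⟨?_, fun hw => Or.inl ⟨U, hU, hx, hw⟩⟩ rfl rfl
    rintro (⟨V, hV, hVx, hw⟩ | ⟨-, hno⟩)
    · rwa [huniq i U hU V hV x hx hVx]
    · exact absurd ⟨U, hU, hx⟩ hno
  have hout : ∀ i, IsHalfSpaceOutside (B + 2) i (f i) := by
    intro i x hx
    by_cases hex : ∃ U ∈ 𝒰 i, ∃ u, φ u ∈ U ∧ near u x
    · obtain ⟨U, hU, u, hu, hux⟩ := hex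
      rw [hconst i U hU x ⟨u, hu, hux⟩]
      have h1 := hux i
      refine if_congr ⟨?_, fun hxi => ⟨u, hu, ?_⟩⟩ rfl rfl
      · rintro ⟨w, hw, hwi⟩
        have h2 := hm i U hU _ hu _ hw
        rw [dist_eq_dist_sub_zero, ← map_sub] at h2
        have h3 := abs_le.1 (hB _ h2 i)
        rw [Pi.sub_apply] at h3
        rcases le_abs.1 hx with h4 | h4 <;> omega
      · rw [abs_of_nonneg hxi] at hx
        omega
    · refine if_congr ⟨?_, fun hxi => Or.inr ⟨hxi, hex⟩⟩ rfl rfl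
      rintro (⟨U, hU, hUx, -⟩ | ⟨hxi, -⟩)
      · exact absurd ⟨U, hU, hUx⟩ hex
      · exact hxi
  obtain ⟨v, π, hv⟩ := exists_kuhnVertex_ne (by omega) hout
  obtain ⟨i, U, hU, hvU⟩ := hcov (φ v)
  refine hv i ?_
  have h1 := fun j => hconst i U hU (kuhnVertex v π j)
    ⟨v, hvU, fun l => ⟨le_kuhnVertex v π j l, kuhnVertex_le v π j l⟩⟩
  rw [h1, h1]

theorem asdim_finsupp_int_eq_top [MetricSpace (ℕ →₀ ℤ)] [ProperSpace (ℕ →₀ ℤ)]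
    [IsIsometricVAdd (ℕ →₀ ℤ) (ℕ →₀ ℤ)] : asdim (ℕ →₀ ℤ) = ⊤ := by
  rw [asdim_eq_top_iff]
  intro n
  refine not_asdimLE_of_injective ((Finsupp.embDomain.addMonoidHom Fin.valEmbedding).comp
    (Finsupp.linearEquivFunOnFinite ℤ ℤ (Fin (n + 1))).symm.toAddMonoidHom) ?_
  exact (Finsupp.embDomain_injective _).comp (LinearEquiv.injective _)

end Kuhn

/-! ### Upper bound: finite rank implies finite asymptotic dimension -/

section FiniteRank

variable {A : Type u} [AddCommGroup A]

theorem exists_rational_coordinates (H : AddSubgroup A) (hH : H.FG)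
    (htors : ∀ x : A, ∃ k : ℤ, k ≠ 0 ∧ k • x ∈ H) :
    ∃ (ι : Type u) (_ : Finite ι) (b : ι → A) (φ : A →+ (ι → ℚ)),
      (∀ (c : ι →₀ ℤ) (i : ι), φ (Finsupp.linearCombination ℤ b c) i = c i) ∧
      ∀ x : A, ∃ k : ℤ, k ≠ 0 ∧ k • x ∈ Submodule.span ℤ (Set.range b) := by
  obtain ⟨T, rfl⟩ := hH
  obtain ⟨s, hs, hmax⟩ := exists_maximal_linearIndepOn ℤ (Subtype.val : T → A)
  let b : s → A := fun i => i.1.1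
  have hb : Function.Injective (Finsupp.linearCombination ℤ b) := hs
  -- A divisible group is injective, so the coordinates on the free subgroup extend to all of `A`.
  obtain ⟨φ, hφ⟩ := (Module.Baer.of_divisible (s → ℚ)).extension_property_addMonoidHom
    (Finsupp.linearCombination ℤ b).toAddMonoidHom hb
    ((Finsupp.coeFnAddHom : (s →₀ ℚ) →+ _).comp
      (Finsupp.mapRange.addMonoidHom (Int.castAddHom ℚ)))
  refine ⟨s, inferInstance, b, φ, fun c i => ?_, fun x => ?_⟩
  · exact congrFun (DFunLike.congr_fun hφ c) i
  · have hrange : Set.range b = Subtype.val '' s := by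
      ext; simp [b]
    have key : ∀ y ∈ AddSubgroup.closure (T : Set A),
        ∃ k : ℤ, k ≠ 0 ∧ k • y ∈ Submodule.span ℤ (Set.range b) := by
      intro y hy
      induction hy using AddSubgroup.closure_induction with
      | mem y hy =>
        by_cases hys : (⟨y, hy⟩ : T) ∈ s
        · exact ⟨1, one_ne_zero, by
            rw [one_smul]; exact Submodule.subset_span ⟨⟨⟨y, hy⟩, hys⟩, rfl⟩⟩
        · rw [hrange]
          exact hmax _ hys
      | zero => exact ⟨1, one_ne_zero, by rw [smul_zero]; exact zero_mem _⟩
      | add y z _ _ hy hz =>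
        obtain ⟨k, hk, hky⟩ := hy
        obtain ⟨l, hl, hlz⟩ := hz
        refine ⟨k * l, mul_ne_zero hk hl, ?_⟩
        rw [smul_add]
        refine add_mem ?_ ?_
        · rw [mul_comm, mul_smul]
          exact Submodule.smul_mem _ _ hky
        · rw [mul_smul]
          exact Submodule.smul_mem _ _ hlz
      | neg y _ hy =>
        obtain ⟨k, hk, hky⟩ := hy
        exact ⟨k, hk, by rw [smul_neg]; exact neg_mem hky⟩
    obtain ⟨k, hk, hkx⟩ := htors x
    obtain ⟨l, hl, hlx⟩ := key _ hkx
    exact ⟨l * k, mul_ne_zero hl hk, by rwa [mul_smul]⟩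

/-- The image of `K` modulo the span of `b` is finitely generated and torsion, hence finite; each
coset contributes a translate of a bounded set of lattice points. -/
theorem finite_setOf_abs_coordinates_le {ι : Type*} [Finite ι] {b : ι → A} {φ : A →+ (ι → ℚ)}
    (hφ : ∀ (c : ι →₀ ℤ) (i : ι), φ (Finsupp.linearCombination ℤ b c) i = c i)
    (htors : ∀ x : A, ∃ k : ℤ, k ≠ 0 ∧ k • x ∈ Submodule.span ℤ (Set.range b))
    {K : Submodule ℤ A} (hK : K.FG) (L : ℚ) : {x | x ∈ K ∧ ∀ i, |φ x i| ≤ L}.Finite := by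
  classical
  have := Fintype.ofFinite ι
  have hfree : ∀ L : ℚ,
      {x | x ∈ Submodule.span ℤ (Set.range b) ∧ ∀ i, |φ x i| ≤ L}.Finite := by
    intro L
    refine ((Set.finite_Icc (fun _ : ι => -⌈L⌉) fun _ => ⌈L⌉).image fun c =>
      Finsupp.linearCombination ℤ b (Finsupp.equivFunOnFinite.symm c)).subset ?_
    rintro x ⟨hx, hxL⟩
    obtain ⟨c, rfl⟩ := (Finsupp.mem_span_range_iff_exists_finsupp).1 hx
    refine ⟨c, ?_, by simp [Finsupp.linearCombination_apply]⟩
    have h1 : ∀ i, |c i| ≤ ⌈L⌉ := by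
      intro i
      have h2 := hxL i
      rw [← Finsupp.linearCombination_apply, hφ] at h2
      have h3 : ((|c i| : ℤ) : ℚ) ≤ (⌈L⌉ : ℤ) := by
        rw [Int.cast_abs]
        exact h2.trans (Int.le_ceil L)
      exact_mod_cast h3
    exact ⟨fun i => (abs_le.1 (h1 i)).1, fun i => (abs_le.1 (h1 i)).2⟩
  have hquot : Finite (K.map (Submodule.span ℤ (Set.range b)).mkQ) := by
    have : Module.Finite ℤ (K.map (Submodule.span ℤ (Set.range b)).mkQ) :=
      Module.Finite.iff_fg.2 (hK.map _)
    refine Module.finite_of_fg_torsion _ ?_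
    rintro ⟨_, x, -, rfl⟩
    obtain ⟨k, hk, hkx⟩ := htors x
    refine ⟨⟨k, mem_nonZeroDivisors_of_ne_zero hk⟩, Subtype.ext ?_⟩
    exact (Submodule.Quotient.mk_eq_zero _).2 hkx
  have hfin : {q | q ∈ K.map (Submodule.span ℤ (Set.range b)).mkQ}.Finite :=
    Set.finite_coe_iff.1 hquot
  refine (hfin.biUnion (t := fun q => {x | (Submodule.span ℤ (Set.range b)).mkQ x = q ∧
    ∀ i, |φ x i| ≤ L}) fun q _ => ?_).subset ?_
  · obtain ⟨s, rfl⟩ := Submodule.mkQ_surjective _ q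
    refine ((hfree (L + ∑ i, |φ s i|)).image fun h => s + h).subset ?_
    rintro x ⟨hx, hxL⟩
    refine ⟨x - s, ⟨(Submodule.Quotient.eq _).1 hx, fun i => ?_⟩, by simp⟩
    rw [map_sub, Pi.sub_apply]
    have h1 := Finset.single_le_sum (f := fun i => |φ s i|) (fun _ _ => abs_nonneg _)
      (Finset.mem_univ i)
    have h2 := abs_sub (φ x i) (φ s i)
    have h3 := hxL i
    linarith
  · rintro x ⟨hx, hxL⟩
    simp only [Set.mem_iUnion]
    exact ⟨_, ⟨x, hx, rfl⟩, rfl, hxL⟩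

theorem eq_of_floor_of_parity {x y L : ℚ} (hL : 0 < L) (hxy : |x - y| < L)
    (h : ((⌊x / L⌋ : ℤ) : ZMod 2) = (⌊y / L⌋ : ℤ)) : ⌊x / L⌋ = ⌊y / L⌋ := by
  have h1 : |x / L - y / L| < 1 := by
    rw [← sub_div, abs_div, abs_of_pos hL, div_lt_one hL]
    exact hxy
  rw [abs_lt] at h1
  have h3 := Int.floor_le (x / L)
  have h4 := Int.lt_floor_add_one (x / L)
  have h5 := Int.floor_le (y / L)
  have h6 := Int.lt_floor_add_one (y / L)
  have h7 : ((⌊x / L⌋ : ℤ) : ℚ) < (⌊y / L⌋ + 2 : ℤ) := by push_cast; linarith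
  have h8 : ((⌊y / L⌋ : ℤ) : ℚ) < (⌊x / L⌋ + 2 : ℤ) := by push_cast; linarith
  rw [Int.cast_lt] at h7 h8
  have h9 := (ZMod.intCast_eq_intCast_iff _ _ 2).1 h
  unfold Int.ModEq at h9
  omega

theorem exists_asdimLE_of_torsion_quotient [Countable A] [MetricSpace A] [ProperSpace A]
    [IsIsometricVAdd A A] (H : AddSubgroup A) (hH : H.FG)
    (htors : ∀ x : A, ∃ k : ℤ, k ≠ 0 ∧ k • x ∈ H) : ∃ n, AsdimLE A n := by
  classical
  obtain ⟨ι, _, b, φ, hφ, htors'⟩ := exists_rational_coordinates H hH htors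
  have := Fintype.ofFinite ι
  -- One family of the cover for each parity vector of a box.
  obtain ⟨n, hn⟩ := Nat.exists_eq_succ_of_ne_zero (Fintype.card_ne_zero (α := ι → ZMod 2))
  let e : (ι → ZMod 2) ≃ Fin (n + 1) := Fintype.equivFinOfCardEq hn
  refine ⟨n, fun D _ => ?_⟩
  have hF := finite_closedBall_of_countable (0 : A) D
  let K : Submodule ℤ A := Submodule.span ℤ (Metric.closedBall 0 D)
  have hK : K.FG := Submodule.fg_span hF
  obtain ⟨B, hB⟩ := (hF.image fun x => ∑ i, |φ x i|).bddAbove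
  let L : ℚ := max B 0 + 1
  have hBL : B < L := lt_of_le_of_lt (le_max_left B 0) (lt_add_one _)
  have hL : 0 < L := lt_of_le_of_lt (le_max_right B 0) (lt_add_one _)
  -- Points at distance at most `D` lie in the same coset of `K`, and their coordinates differ by
  -- less than `L`; boxes of equal parity containing them must then coincide.
  let cell : A ⧸ K → (ι → ℤ) → Set A := fun κ z => {x | K.mkQ x = κ ∧ ∀ i, ⌊φ x i / L⌋ = z i}
  refine ⟨fun j => {U | ∃ κ z, U = cell κ z ∧ e (fun i => (z i : ZMod 2)) = j}, ?_, ?_, ?_⟩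
  · exact fun x => ⟨_, _, ⟨K.mkQ x, fun i => ⌊φ x i / L⌋, rfl, rfl⟩, rfl, fun i => rfl⟩
  · obtain ⟨M, hM⟩ := ((finite_setOf_abs_coordinates_le hφ htors' hK L).image
      fun x => dist x 0).bddAbove
    refine ⟨M, ?_⟩
    rintro j _ ⟨κ, z, rfl, -⟩ x ⟨hx, hxz⟩ y ⟨hy, hyz⟩
    rw [dist_eq_dist_sub_zero]
    refine hM ⟨x - y, ⟨(Submodule.Quotient.eq _).1 (hx.trans hy.symm), fun i => ?_⟩, rfl⟩
    have h1 := Int.abs_sub_lt_one_of_floor_eq_floor ((hxz i).trans (hyz i).symm)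
    rw [← sub_div, abs_div, abs_of_pos hL, div_lt_one hL] at h1
    rw [map_sub]
    exact h1.le
  · rintro j _ ⟨κ, z, rfl, hz⟩ _ ⟨κ', z', rfl, hz'⟩ hne x ⟨hx, hxz⟩ y ⟨hy, hyz⟩
    by_contra hlt
    have hmem : x - y ∈ Metric.closedBall (0 : A) D := by
      rw [Metric.mem_closedBall, ← dist_eq_dist_sub_zero]
      exact (not_le.1 hlt).le
    refine hne ?_
    have hκ : κ = κ' := by
      rw [← hx, ← hy]
      exact (Submodule.Quotient.eq _).2 (Submodule.subset_span hmem)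
    have hzz : z = z' := by
      funext i
      rw [← hxz i, ← hyz i]
      refine eq_of_floor_of_parity hL ?_ ?_
      · have h1 := hB ⟨_, hmem, rfl⟩
        have h2 := Finset.single_le_sum (f := fun i => |φ (x - y) i|)
          (fun _ _ => abs_nonneg _) (Finset.mem_univ i)
        simp only [map_sub, Pi.sub_apply] at h1 h2
        exact lt_of_le_of_lt (h2.trans h1) hBL
      · rw [hxz i, hyz i]
        exact congrFun (e.injective (hz.trans hz'.symm)) i
    rw [hκ, hzz]

theorem exists_infinite_order_of_asdim_eq_top [Countable A] [MetricSpace A] [ProperSpace A]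
    [IsIsometricVAdd A A] (h : asdim A = ⊤) (H : AddSubgroup A) (hH : H.FG) :
    ∃ b, ∀ k : ℤ, k ≠ 0 → k • b ∉ H := by
  by_contra! hcon
  obtain ⟨n, hn⟩ := exists_asdimLE_of_torsion_quotient H hH hcon
  exact asdim_eq_top_iff.1 h n hn

end FiniteRank

/-! ### Digit expansions and the equivalence with the direct sum -/

section MixedRadix

variable {A : Type*} [AddCommGroup A]

/-- The subgroup generated by the first `n` terms of two sequences. -/
def initialClosure (t a : ℕ → A) (n : ℕ) : AddSubgroup A :=
  AddSubgroup.closure (t '' Set.Iio n ∪ a '' Set.Iio n)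

/-- The digit expansion with digits `z n`, split by division with remainder by `m n` into
multiples of `t n` and of `a n`. -/
noncomputable def mixedRadix (t a : ℕ → A) (m : ℕ → ℤ) (z : ℕ →₀ ℤ) : A :=
  z.sum fun n k => (k % m n) • t n + (k / m n) • a n

/-- Relative to the earlier terms, `t n` has order `m n` and `a n` has infinite order. -/
structure IsMixedRadixSystem (t a : ℕ → A) (m : ℕ → ℤ) : Prop where
  pos : ∀ n, 0 < m n
  smul_mem : ∀ n, m n • t n ∈ initialClosure t a n
  smul_notMem : ∀ n (i : ℤ), 0 < i → i < m n → i • t n ∉ initialClosure t a n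
  infinite_order : ∀ n (k : ℤ), k ≠ 0 → k • a n ∉ initialClosure t a n
  exhaustive : ∀ x, ∃ n, x ∈ initialClosure t a n

variable {t a : ℕ → A} {m : ℕ → ℤ}

theorem initialClosure_mono : Monotone (initialClosure t a) := fun _ _ h =>
  AddSubgroup.closure_mono (Set.union_subset_union
    (Set.image_mono (Set.Iio_subset_Iio h)) (Set.image_mono (Set.Iio_subset_Iio h)))

theorem initialClosure_zero : initialClosure t a 0 = ⊥ := by
  simp [initialClosure]

theorem left_mem_initialClosure {i n : ℕ} (h : i < n) : t i ∈ initialClosure t a n :=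
  AddSubgroup.subset_closure (Or.inl ⟨i, h, rfl⟩)

theorem right_mem_initialClosure {i n : ℕ} (h : i < n) : a i ∈ initialClosure t a n :=
  AddSubgroup.subset_closure (Or.inr ⟨i, h, rfl⟩)

theorem initialClosure_succ (n : ℕ) :
    initialClosure t a (n + 1) = initialClosure t a n ⊔ AddSubgroup.closure {t n, a n} := by
  rw [initialClosure, initialClosure, ← AddSubgroup.closure_union]
  congr 1
  have h : Set.Iio (n + 1) = insert n (Set.Iio n) := by
    ext; simp
  rw [h, Set.image_insert_eq, Set.image_insert_eq]
  ext x
  simp only [Set.mem_union, Set.mem_insert_iff, Set.mem_singleton_iff]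
  tauto

theorem mixedRadix_eq_sum {z : ℕ →₀ ℤ} {N : ℕ} (h : ∀ i, N ≤ i → z i = 0) :
    mixedRadix t a m z
      = ∑ n ∈ Finset.range N, ((z n % m n) • t n + (z n / m n) • a n) := by
  refine Finsupp.sum_of_support_subset _ (fun i hi => ?_) _ (by simp)
  by_contra hlt
  exact (Finsupp.mem_support_iff.1 hi) (h i (by simpa using hlt))

theorem exists_forall_ge_eq_zero (z : ℕ →₀ ℤ) : ∃ N, ∀ i, N ≤ i → z i = 0 := by
  refine ⟨z.support.sup id + 1, fun i hi => ?_⟩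
  by_contra hne
  have h : id i ≤ z.support.sup id := Finset.le_sup (Finsupp.mem_support_iff.2 hne)
  simp only [id] at h
  omega

theorem mixedRadix_update (z : ℕ →₀ ℤ) (n : ℕ) (k : ℤ) :
    mixedRadix t a m (z.update n k) = mixedRadix t a m z
      - ((z n % m n) • t n + (z n / m n) • a n) + ((k % m n) • t n + (k / m n) • a n) := by
  obtain ⟨N, hN⟩ := exists_forall_ge_eq_zero z
  have h1 : ∀ i, max N (n + 1) ≤ i → z i = 0 := fun i hi => hN i (le_trans (le_max_left _ _) hi)
  have h2 : ∀ i, max N (n + 1) ≤ i → z.update n k i = 0 := fun i hi => by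
    have h3 := le_trans (le_max_right N (n + 1)) hi
    rw [Finsupp.update_apply, if_neg (by omega), h1 i hi]
  have hn : n ∈ Finset.range (max N (n + 1)) := by simp
  rw [mixedRadix_eq_sum h1, mixedRadix_eq_sum h2, ← Finset.add_sum_erase _ _ hn,
    ← Finset.add_sum_erase _ _ hn, Finset.sum_congr rfl (g := fun i =>
      (z i % m i) • t i + (z i / m i) • a i) (s₁ := (Finset.range (max N (n + 1))).erase n)]
  · simp only [Finsupp.update_apply, if_true]
    abel
  · intro i hi
    rw [Finsupp.update_apply, if_neg (Finset.ne_of_mem_erase hi)]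

theorem mixedRadix_sub_mem {w z : ℕ →₀ ℤ} {n : ℕ} (h : ∀ i, n ≤ i → w i = z i) :
    mixedRadix t a m w - mixedRadix t a m z ∈ initialClosure t a n := by
  obtain ⟨N, hN⟩ := exists_forall_ge_eq_zero w
  obtain ⟨N', hN'⟩ := exists_forall_ge_eq_zero z
  rw [mixedRadix_eq_sum (N := max N N') fun i hi => hN i (le_trans (le_max_left _ _) hi),
    mixedRadix_eq_sum (N := max N N') fun i hi => hN' i (le_trans (le_max_right _ _) hi),
    ← Finset.sum_sub_distrib]
  refine sum_mem fun i _ => ?_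
  rcases lt_or_ge i n with hi | hi
  · exact sub_mem
      (add_mem (zsmul_mem (left_mem_initialClosure hi) _)
        (zsmul_mem (right_mem_initialClosure hi) _))
      (add_mem (zsmul_mem (left_mem_initialClosure hi) _)
        (zsmul_mem (right_mem_initialClosure hi) _))
  · rw [h i hi, sub_self]
    exact zero_mem _

theorem update_eq_of_succ_le {w z : ℕ →₀ ℤ} {n : ℕ} (h : ∀ i, n + 1 ≤ i → w i = z i) :
    ∀ i, n ≤ i → w.update n (z n) i = z i := by
  intro i hi
  rw [Finsupp.update_apply]
  split_ifs with hin
  · rw [hin]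
  · exact h i (by omega)

theorem digit_sub_mem {w z : ℕ →₀ ℤ} {n : ℕ} (h : ∀ i, n + 1 ≤ i → w i = z i) :
    (mixedRadix t a m w - mixedRadix t a m z) -
      ((w n % m n - z n % m n) • t n + (w n / m n - z n / m n) • a n)
      ∈ initialClosure t a n := by
  have h1 := mixedRadix_sub_mem (t := t) (a := a) (m := m) (update_eq_of_succ_le h)
  rw [mixedRadix_update] at h1
  convert h1 using 1
  rw [sub_smul, sub_smul]
  abel

namespace IsMixedRadixSystem

/-- Multiplying by `m n` removes the `t n` term modulo the subgroup, so the infinite order of `a n`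
gives `q = 0`; then `r` is smaller than the relative order of `t n`. -/
theorem digit_eq_zero (h : IsMixedRadixSystem t a m) {n : ℕ} {r q : ℤ} (hr : |r| < m n)
    (hmem : r • t n + q • a n ∈ initialClosure t a n) : r = 0 ∧ q = 0 := by
  have hq : q = 0 := by
    by_contra hq
    have h1 := zsmul_mem hmem (m n)
    have h2 := sub_mem h1 (zsmul_mem (h.smul_mem n) r)
    refine h.infinite_order n (m n * q) (mul_ne_zero (h.pos n).ne' hq) ?_
    convert h2 using 1
    rw [smul_add, smul_smul, smul_smul, smul_smul, mul_comm r]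
    abel
  subst hq
  rw [zero_smul, add_zero] at hmem
  refine ⟨?_, rfl⟩
  rw [abs_lt] at hr
  rcases lt_trichotomy r 0 with hr0 | hr0 | hr0
  · refine absurd (neg_mem hmem) ?_
    rw [← neg_smul]
    exact h.smul_notMem n _ (by omega) (by omega)
  · exact hr0
  · exact absurd hmem (h.smul_notMem n r hr0 hr.2)

theorem abs_emod_sub_emod_lt (h : IsMixedRadixSystem t a m) (n : ℕ) (k l : ℤ) :
    |k % m n - l % m n| < m n := by
  have h0 := h.pos n
  have h1 := Int.emod_nonneg k h0.ne'
  have h2 := Int.emod_nonneg l h0.ne'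
  have h3 := Int.emod_lt_of_pos k h0
  have h4 := Int.emod_lt_of_pos l h0
  rw [abs_lt]
  omega

theorem eq_of_emod_of_ediv {k l d : ℤ} (h1 : k % d - l % d = 0) (h2 : k / d - l / d = 0) :
    k = l := by
  rw [← Int.emod_add_mul_ediv k d, ← Int.emod_add_mul_ediv l d, sub_eq_zero.1 h1,
    sub_eq_zero.1 h2]

/-- Descend from a place beyond both supports: `digit_eq_zero` makes the highest undecided digits
agree. -/
theorem apply_eq_of_sub_mem (h : IsMixedRadixSystem t a m) {w z : ℕ →₀ ℤ} {N : ℕ}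
    (hmem : mixedRadix t a m w - mixedRadix t a m z ∈ initialClosure t a N) :
    ∀ i, N ≤ i → w i = z i := by
  have key : ∀ k, (∀ i, N + k ≤ i → w i = z i) → ∀ i, N ≤ i → w i = z i := by
    intro k
    induction k with
    | zero => exact fun h => h
    | succ k ih =>
      intro hk
      have h1 := digit_sub_mem (t := t) (a := a) (m := m) hk
      have h2 := (sub_mem_comm_iff.1 h1)
      have h3 := add_mem h2 (initialClosure_mono (Nat.le_add_right N k) hmem)
      rw [sub_add_cancel] at h3
      obtain ⟨h4, h5⟩ := h.digit_eq_zero (h.abs_emod_sub_emod_lt _ _ _) h3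
      refine ih fun i hi => ?_
      rcases hi.eq_or_lt with rfl | hi
      · exact eq_of_emod_of_ediv h4 h5
      · exact hk i hi
  obtain ⟨M, hM⟩ := exists_forall_ge_eq_zero w
  obtain ⟨M', hM'⟩ := exists_forall_ge_eq_zero z
  refine key (max M M') fun i hi => ?_
  rw [hM i (by omega), hM' i (by omega)]

theorem injective (h : IsMixedRadixSystem t a m) : Function.Injective (mixedRadix t a m) := by
  intro w z hwz
  ext i
  exact h.apply_eq_of_sub_mem (N := 0) (by rw [hwz, sub_self]; exact zero_mem _) i i.zero_le

theorem surjective (h : IsMixedRadixSystem t a m) :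
    Function.Surjective (mixedRadix t a m) := by
  have key : ∀ n, ∀ x ∈ initialClosure t a n,
      ∃ z : ℕ →₀ ℤ, (∀ i, n ≤ i → z i = 0) ∧ mixedRadix t a m z = x := by
    intro n
    induction n with
    | zero =>
      intro x hx
      rw [initialClosure_zero, AddSubgroup.mem_bot] at hx
      exact ⟨0, by simp, by simp [mixedRadix, hx]⟩
    | succ n ih =>
      intro x hx
      rw [initialClosure_succ, AddSubgroup.mem_sup] at hx
      obtain ⟨y, hy, u, hu, rfl⟩ := hx
      obtain ⟨i, j, rfl⟩ := AddSubgroup.mem_closure_pair.1 hu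
      -- The multiple of `m n • t n` is carried into the lower subgroup.
      obtain ⟨z, hz, hzy⟩ := ih (y + (i / m n) • m n • t n)
        (add_mem hy (zsmul_mem (h.smul_mem n) _))
      have h0 := h.pos n
      have h1 : (i % m n + m n * j) % m n = i % m n := by simp
      have h2 : (i % m n + m n * j) / m n = j := by
        rw [Int.add_mul_ediv_left _ _ h0.ne', Int.ediv_eq_zero_of_lt (Int.emod_nonneg _ h0.ne')
          (Int.emod_lt_of_pos _ h0), zero_add]
      refine ⟨z.update n (i % m n + m n * j), fun l hl => ?_, ?_⟩
      · rw [Finsupp.update_apply, if_neg (by omega), hz l (by omega)]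
      · rw [mixedRadix_update, hzy, hz n le_rfl, h1, h2]
        nth_rewrite 3 [← Int.emod_add_mul_ediv i (m n)]
        simp only [Int.zero_emod, Int.zero_ediv, zero_smul, add_zero, sub_zero, add_smul,
          smul_smul, mul_comm (m n)]
        abel
  intro x
  obtain ⟨n, hn⟩ := h.exhaustive x
  obtain ⟨z, -, hz⟩ := key n x hn
  exact ⟨z, hz⟩

theorem bijective (h : IsMixedRadixSystem t a m) : Function.Bijective (mixedRadix t a m) :=
  ⟨h.injective, h.surjective⟩

theorem emod_sub_emod_add (k l d : ℤ) :
    (k % d - l % d) + d * (k / d - l / d) = k - l := by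
  have h1 := Int.emod_add_mul_ediv k d
  have h2 := Int.emod_add_mul_ediv l d
  linear_combination h1 - h2

theorem preservesFiniteDiff (h : IsMixedRadixSystem t a m) :
    PreservesFiniteDiff (mixedRadix t a m) := by
  have key : ∀ n, ∀ F : Set (ℕ →₀ ℤ), F.Finite → ∃ F' : Set A, F'.Finite ∧
      ∀ w z : ℕ →₀ ℤ, (∀ i, n ≤ i → w i = z i) → w - z ∈ F →
        mixedRadix t a m w - mixedRadix t a m z ∈ F' := by
    intro n
    induction n with
    | zero =>
      refine fun F _ => ⟨{0}, Set.finite_singleton 0, fun w z hwz _ => ?_⟩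
      rw [Finsupp.ext fun i => hwz i i.zero_le, sub_self]
      rfl
    | succ n ih =>
      intro F hF
      -- Resetting digit `n` of `w` to that of `z` reduces to lower digits. The correction depends
      -- only on the digit difference and on the difference of remainders, which has finitely many
      -- values.
      obtain ⟨F₁, hF₁, hw⟩ := ih _ (hF.image fun f => f.update n 0)
      refine ⟨_, hF₁.image2 (fun b (p : (ℕ →₀ ℤ) × ℤ) =>
        b + (p.2 • t n + ((p.1 n - p.2) / m n) • a n))
        (hF.prod (Set.finite_Ioo (-m n) (m n))), fun w z hwz hmem => ?_⟩
      refine ⟨_, hw (w.update n (z n)) z (update_eq_of_succ_le hwz) ⟨w - z, hmem, ?_⟩,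
        (w - z, w n % m n - z n % m n),
        ⟨hmem, abs_lt.1 (h.abs_emod_sub_emod_lt n (w n) (z n))⟩, ?_⟩
      · ext i
        simp only [Finsupp.update_apply, Finsupp.sub_apply]
        split_ifs with hi
        · rw [hi, sub_self]
        · rfl
      · have h1 : (w n - z n - (w n % m n - z n % m n)) / m n = w n / m n - z n / m n := by
          rw [← emod_sub_emod_add (w n) (z n) (m n), add_sub_cancel_left,
            Int.mul_ediv_cancel_left _ (h.pos n).ne']
        simp only [Finsupp.sub_apply]
        rw [h1, mixedRadix_update, sub_smul, sub_smul]
        abel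
  intro F hF
  obtain ⟨N, hN⟩ : ∃ N, ∀ f ∈ F, ∀ i, N ≤ i → f i = 0 := by
    choose N hN using exists_forall_ge_eq_zero
    obtain ⟨B, hB⟩ := (hF.image N).bddAbove
    exact ⟨B, fun f hf i hi => hN f i (le_trans (hB ⟨f, hf, rfl⟩) hi)⟩
  obtain ⟨F', hF', hw⟩ := key N F hF
  exact ⟨F', hF', fun w z hwz => hw w z (fun i hi => sub_eq_zero.1 (hN _ hwz i hi)) hwz⟩

theorem finite_sub_of_finite_sub (h : IsMixedRadixSystem t a m) (F : Set A) (hF : F.Finite) :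
    ∃ F' : Set (ℕ →₀ ℤ), F'.Finite ∧
      ∀ w z, mixedRadix t a m w - mixedRadix t a m z ∈ F → w - z ∈ F' := by
  have key : ∀ n, ∀ F : Set A, F.Finite → ∃ F' : Set (ℕ →₀ ℤ), F'.Finite ∧
      ∀ w z : ℕ →₀ ℤ, (∀ i, n ≤ i → w i = z i) →
        mixedRadix t a m w - mixedRadix t a m z ∈ F → w - z ∈ F' := by
    intro n
    induction n with
    | zero =>
      refine fun F _ => ⟨{0}, Set.finite_singleton 0, fun w z hwz _ => ?_⟩
      rw [Finsupp.ext fun i => hwz i i.zero_le, sub_self]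
      rfl
    | succ n ih =>
      intro F hF
      -- Given `d` and the remainder difference `r`, at most one quotient difference is possible, as
      -- `a n` has infinite order relative to the earlier terms.
      have hQ : (⋃ r ∈ Set.Ioo (-m n) (m n), ⋃ d ∈ F,
          {p : ℤ × ℤ | p.1 = r ∧ d - (r • t n + p.2 • a n) ∈ initialClosure t a n}).Finite := by
        refine (Set.finite_Ioo _ _).biUnion fun r _ => hF.biUnion fun d _ => ?_
        refine Set.Subsingleton.finite ?_
        rintro ⟨_, q⟩ ⟨rfl, hq⟩ ⟨_, q'⟩ ⟨rfl, hq'⟩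
        refine Prod.ext rfl ?_
        by_contra hne
        refine h.infinite_order n (q' - q) (sub_ne_zero.2 (Ne.symm hne)) ?_
        convert sub_mem hq hq' using 1
        rw [sub_smul]
        abel
      obtain ⟨F₁, hF₁, hw⟩ := ih _ (hF.image2
        (fun d (p : ℤ × ℤ) => d - (p.1 • t n + p.2 • a n)) hQ)
      refine ⟨_, hF₁.image2 (fun f (p : ℤ × ℤ) => f.update n (p.1 + m n * p.2)) hQ,
        fun w z hwz hmem => ?_⟩
      have hp : (w n % m n - z n % m n, w n / m n - z n / m n) ∈
          ⋃ r ∈ Set.Ioo (-m n) (m n), ⋃ d ∈ F,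
            {p : ℤ × ℤ | p.1 = r ∧ d - (r • t n + p.2 • a n) ∈ initialClosure t a n} := by
        simp only [Set.mem_iUnion]
        exact ⟨_, abs_lt.1 (h.abs_emod_sub_emod_lt n (w n) (z n)), _, hmem, rfl,
          digit_sub_mem hwz⟩
      refine ⟨_, hw (w.update n (z n)) z (update_eq_of_succ_le hwz) ⟨_, hmem, _, hp, ?_⟩,
        _, hp, ?_⟩
      · simp only
        rw [mixedRadix_update, sub_smul, sub_smul]
        abel
      · ext i
        simp only [Finsupp.update_apply, Finsupp.sub_apply, emod_sub_emod_add]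
        split_ifs with hi
        · rw [hi]
        · rfl
  obtain ⟨N, hN⟩ : ∃ N, ∀ x ∈ F, x ∈ initialClosure t a N := by
    choose N hN using h.exhaustive
    obtain ⟨B, hB⟩ := (hF.image N).bddAbove
    exact ⟨B, fun x hx => initialClosure_mono (hB ⟨x, hx, rfl⟩) (hN x)⟩
  obtain ⟨F', hF', hw⟩ := key N F hF
  exact ⟨F', hF', fun w z hwz => hw w z (h.apply_eq_of_sub_mem (hN _ hwz)) hwz⟩

theorem bijectivelyCoarselyEquivalent (h : IsMixedRadixSystem t a m) [Countable A]
    [MetricSpace A] [ProperSpace A] [IsIsometricVAdd A A] [MetricSpace (ℕ →₀ ℤ)]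
    [ProperSpace (ℕ →₀ ℤ)] [IsIsometricVAdd (ℕ →₀ ℤ) (ℕ →₀ ℤ)] :
    BijectivelyCoarselyEquivalent (ℕ →₀ ℤ) A := by
  refine bijectivelyCoarselyEquivalent_iff_exists_equiv.2
    ⟨Equiv.ofBijective _ h.bijective,
      bornologous_of_preservesFiniteDiff h.preservesFiniteDiff,
      bornologous_of_preservesFiniteDiff fun F hF => ?_⟩
  obtain ⟨F', hF', hw⟩ := h.finite_sub_of_finite_sub F hF
  refine ⟨F', hF', fun x y hxy => hw _ _ ?_⟩
  have h1 : ∀ x, mixedRadix t a m ((Equiv.ofBijective _ h.bijective).symm x) = x :=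
    (Equiv.ofBijective _ h.bijective).apply_symm_apply
  rwa [h1, h1]

end IsMixedRadixSystem

/-- One step of the chain, absorbing `g`: if `g` is torsion modulo `H`, it becomes `t` and a fresh
element of infinite order becomes `a`; otherwise `g` is `a`, with `t = 0` of order 1. -/
theorem exists_order_pair
    (hrank : ∀ H : AddSubgroup A, H.FG → ∃ b, ∀ k : ℤ, k ≠ 0 → k • b ∉ H)
    (H : AddSubgroup A) (hH : H.FG) (g : A) :
    ∃ p : A × A × ℤ, 0 < p.2.2 ∧ p.2.2 • p.1 ∈ H ∧
      (∀ i : ℤ, 0 < i → i < p.2.2 → i • p.1 ∉ H) ∧ (∀ k : ℤ, k ≠ 0 → k • p.2.1 ∉ H) ∧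
      g ∈ AddSubgroup.closure {p.1, p.2.1} := by
  by_cases hg : ∃ k : ℕ, 0 < k ∧ k • g ∈ H
  · classical
    obtain ⟨b, hb⟩ := hrank H hH
    have hfind := Nat.find_spec hg
    refine ⟨(g, b, (Nat.find hg : ℕ)), by simp, by simpa using hfind.2,
      fun i hi hlt hmem => ?_, hb, AddSubgroup.subset_closure (by simp)⟩
    lift i to ℕ using hi.le
    refine Nat.find_min hg (m := i) (by simpa using hlt) ⟨by simpa using hi, by simpa using hmem⟩
  · refine ⟨(0, g, 1), one_pos, by simp, fun i hi hlt => ?_, fun k hk hmem => ?_,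
      AddSubgroup.subset_closure (by simp)⟩
    · simp only at hlt
      omega
    · refine hg ⟨k.natAbs, Int.natAbs_pos.2 hk, ?_⟩
      rw [← natCast_zsmul]
      rcases Int.natAbs_eq k with h | h
      · rwa [h] at hmem
      · rw [h, neg_smul] at hmem
        exact neg_mem_iff.1 hmem

theorem exists_isMixedRadixSystem [Countable A]
    (hrank : ∀ H : AddSubgroup A, H.FG → ∃ b, ∀ k : ℤ, k ≠ 0 → k • b ∉ H) :
    ∃ (t a : ℕ → A) (m : ℕ → ℤ), IsMixedRadixSystem t a m := by
  classical
  obtain ⟨g, hg⟩ := exists_surjective_nat A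
  choose p hp using exists_order_pair hrank
  let H : ℕ → {H : AddSubgroup A // H.FG} := fun n => Nat.rec ⟨⊥, ⟨∅, by simp⟩⟩
    (fun n K => ⟨K.1 ⊔ AddSubgroup.closure {(p K.1 K.2 (g n)).1, (p K.1 K.2 (g n)).2.1},
      K.2.sup ⟨{(p K.1 K.2 (g n)).1, (p K.1 K.2 (g n)).2.1}, by simp⟩⟩) n
  let q : ℕ → A × A × ℤ := fun n => p (H n).1 (H n).2 (g n)
  have hH : ∀ n, (H n).1 = initialClosure (fun n => (q n).1) (fun n => (q n).2.1) n := by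
    intro n
    induction n with
    | zero => rw [initialClosure_zero]; rfl
    | succ n ih => rw [initialClosure_succ, ← ih]
  refine ⟨fun n => (q n).1, fun n => (q n).2.1, fun n => (q n).2.2, ?_, ?_, ?_, ?_, ?_⟩
  · exact fun n => (hp _ (H n).2 (g n)).1
  · exact fun n => hH n ▸ (hp _ (H n).2 (g n)).2.1
  · exact fun n => hH n ▸ (hp _ (H n).2 (g n)).2.2.1
  · exact fun n => hH n ▸ (hp _ (H n).2 (g n)).2.2.2.1
  · intro x
    obtain ⟨n, rfl⟩ := hg x
    refine ⟨n + 1, ?_⟩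
    rw [initialClosure_succ]
    exact AddSubgroup.mem_sup_right (hp _ (H n).2 (g n)).2.2.2.2

end MixedRadix

/-! ### The characterization -/

theorem mainTheorem9 (G : Type u) [Group G] [Countable G]
    [MetricSpace G] [ProperSpace G] [IsIsometricSMul G G]
    [MetricSpace (ℕ →₀ ℤ)] [ProperSpace (ℕ →₀ ℤ)] [IsIsometricVAdd (ℕ →₀ ℤ) (ℕ →₀ ℤ)] :
    BijectivelyCoarselyEquivalent G (ℕ →₀ ℤ) ↔
      (∃ (A : Type v) (_ : AddCommGroup A) (_ : Countable A)
          (_ : MetricSpace A) (_ : ProperSpace A) (_ : IsIsometricVAdd A A),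
        BijectivelyCoarselyEquivalent G A) ∧
      asdim G = ⊤ := by
  constructor
  · intro h
    refine ⟨?_, asdim_eq_top_of_bijectivelyCoarselyEquivalent asdim_finsupp_int_eq_top h.symm⟩
    obtain ⟨B, i₁, i₂, i₃, i₄, i₅, hB⟩ := exists_uLift_invariantMetric.{0, v} (A := ℕ →₀ ℤ)
    exact ⟨B, i₁, i₂, i₃, i₄, i₅, h.trans hB⟩
  · rintro ⟨⟨A, _, _, _, _, _, hGA⟩, hdim⟩
    have hA := asdim_eq_top_of_bijectivelyCoarselyEquivalent hdim hGA
    obtain ⟨t, a, m, hsys⟩ :=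
      exists_isMixedRadixSystem (exists_infinite_order_of_asdim_eq_top hA)
    exact hGA.trans hsys.bijectivelyCoarselyEquivalent.symm
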